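/- Let $D\subset\mathbb R^4$ (coordinates $x^1,x^2,y^1,y^2$; superscripts are indices) be a nonempty open set on which $x^1\neq0$, $y^1\neq 0$, $y^2\neq0$, and consider on $D$ the three families of surfaces $$x^i=\mathrm{const},\qquad y^i=\mathrm{const},\qquad f^i(x,y)=\mathrm{const}\quad(i=1,2),\qquad f^1=y^2e^{x^1y^1},\quad f^2=x^2+y^2 .$$ Notation, for a smooth $f$ with $\det(\partial f/\partial x)\ne0\neq\det(\partial f/\partial y)$ (so that the families form a three-web $W(3,2,2)$), with summation over repeated indices. Put $\omega_1^i=\frac{\partial f^i}{\partial x^j}dx^j$, $\omega_2^i=\frac{\partial f^i}{\partial y^j}dy^j$, $\bar g=(\partial f/\partial x)^{-1}$, $\tilde g=(\partial f/\partial y)^{-1}$, $\Gamma^i_{jk}=-\frac{\partial^2f^i}{\partial x^l\partial y^m}\bar g^l_j\tilde g^m_k$, $\omega^i_j=\Gamma^i_{kj}\omega_1^k+\Gamma^i_{jk}\omega_2^k$, $a^i_{jk}=\frac12(\Gamma^i_{jk}-\Gamma^i_{kj})$. The covector $a=(a_1,a_2)$ is given by $a^i_{jk}=\frac12(a_j\delta^i_k-a_k\delta^i_j)$;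 the quantities $p_{ij},q_{ij}$ and $b^i_{jkl}$ are defined by $$da_i-a_j\omega_i^j=p_{ij}\omega_1^j+q_{ij}\omega_2^j,\qquad d\omega^i_j-\omega_j^k\wedge\omega_k^i=b^i_{jkl}\,\omega_1^k\wedge\omega_2^l ,$$ and $p=\frac12(p_{12}-p_{21})$, $q=\frac12(q_{12}-q_{21})$. The web is nonisoclinic if $p^2+q^2>0$ everywhere. Let $\Delta$ be the distribution $a_1\omega_\alpha^1+a_2\omega_\alpha^2=0$ ($\alpha=1,2$). A web is transversally geodesic if for each point and each $\xi\ne0$ in $\mathbb R^2$ there is a smooth immersed surface through the point with tangent plane there $\{\xi^2\omega_\alpha^1=\xi^1\omega_\alpha^2,\ \alpha=1,2\}$, whose tangent plane at each of its points is of this form for some $\xi\neq0$ depending on the point; the corresponding tensor condition is that at each point $b^i_{(jkl)}=\delta^i_{(j}b_{kl)}$ for some $b_{kl}$ (round brackets denote symmetrization). Claim. The given families form a three-web on $D$, with $a\ne0$ everywhere, and it is nonisoclinic. Moreover, on $D$: 1. (Class $A_3$) $\Delta$ is the distribution $\omega_1^2=\omega_2^2=0$ and is integrable; $a_1=0$,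 the form $\omega_1^{\,2}$ (that is, $\omega_j^i$ with $j=1,\,i=2$) vanishes on all vectors annihilated by all $\omega^i_\alpha$, and $p_{11}=q_{11}=0$. 2. (Class $A_{31}$) The integral surfaces of $\Delta$ are geodesically parallel in every affine connection with connection forms $\mathrm{diag}(\theta^i_j,\theta^i_j)$, $\theta^i_j=\omega^i_j+a^i_{jk}(P\omega_1^k+Q\omega_2^k)$, $P,Q$ arbitrary functions, i.e. $\nabla_XV\in\Delta$ for every smooth section $V$ of $\Delta$ and every vector $X$; and $p_{1i}=q_{1i}=0$ for $i=1,2$. 3. (Class $A_{32}$) The two-dimensional three-web cut by the three foliations on any integral surface of $\Delta$ is hexagonal (all sufficiently small hexagonal figures close); and $b^1_{111}=b^2_{111}=0$. 4. (Class $E_{321}$) $p_{1i}=q_{1i}=0$, $p_{21}=q_{21}$, $p_{22}=0$. 5. (Class $G_3$) $p=q\neq0$. 6. $b^2_{jkl}=0$ for all $j,k,l$, but the tensor $b^i_{jkl}$ does not vanish identically on $D$ (the web is not a group web). The web is not transversally geodesic, and the tensor condition $b^i_{(jkl)}=\delta^i_{(j}b_{kl)}$ fails. -/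

import Mathlib

open scoped ContDiff Topology

noncomputable section

namespace Web322

/-! Three-webs `W(3,2,2)` on open subsets of `ℝ⁴`, given by
`x = const`, `y = const`, `f(x, y) = const` with `x, y` and the values of `f` in `ℝ²`.
The indices `1, 2` of the usual tensor notation are `0, 1 : Fin 2` here. -/

/-- Points (and tangent vectors) of `ℝ⁴`, split as `(x, y) = ((x¹, x²), (y¹, y²))`. -/
abbrev Pt : Type := (Fin 2 → ℝ) × (Fin 2 → ℝ)

/-- The matrix `∂fⁱ/∂xʲ`. -/
def dX (f : Pt → Fin 2 → ℝ) (z : Pt) : Matrix (Fin 2) (Fin 2) ℝ :=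
  Matrix.of fun i j => fderiv ℝ f z (Pi.single j 1, 0) i

/-- The matrix `∂fⁱ/∂yʲ`. -/
def dY (f : Pt → Fin 2 → ℝ) (z : Pt) : Matrix (Fin 2) (Fin 2) ℝ :=
  Matrix.of fun i j => fderiv ℝ f z (0, Pi.single j 1) i

/-- `f` defines on the open set `D` a three-web: it is smooth and the leaves of the three
foliations are pairwise transversal. -/
structure IsWeb (f : Pt → Fin 2 → ℝ) (D : Set Pt) : Prop where
  isOpen : IsOpen D
  smooth : ContDiffOn ℝ ∞ f D
  det_dX : ∀ z ∈ D, (dX f z).det ≠ 0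
  det_dY : ∀ z ∈ D, (dY f z).det ≠ 0

/-- The form `ω₁ⁱ = (∂fⁱ/∂xʲ) dxʲ` at `z`, evaluated on `v`. -/
def om1 (f : Pt → Fin 2 → ℝ) (i : Fin 2) (z v : Pt) : ℝ := ∑ j, dX f z i j * v.1 j

/-- The form `ω₂ⁱ = (∂fⁱ/∂yʲ) dyʲ` at `z`, evaluated on `v`. -/
def om2 (f : Pt → Fin 2 → ℝ) (i : Fin 2) (z v : Pt) : ℝ := ∑ j, dY f z i j * v.2 j

/-- The frame vector `e₁ₖ`; with `e₂ₖ` it is the frame dual to the coframe `ω₁ⁱ, ω₂ⁱ`. -/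
def fr1 (f : Pt → Fin 2 → ℝ) (k : Fin 2) (z : Pt) : Pt := (fun l => (dX f z)⁻¹ l k, 0)

/-- The frame vector `e₂ₖ`. -/
def fr2 (f : Pt → Fin 2 → ℝ) (k : Fin 2) (z : Pt) : Pt := (0, fun l => (dY f z)⁻¹ l k)

/-- The mixed derivative `∂²fⁱ/∂xˡ∂yᵐ`. -/
def mixed (f : Pt → Fin 2 → ℝ) (i l m : Fin 2) (z : Pt) : ℝ :=
  fderiv ℝ (fun w => dY f w i m) z (Pi.single l 1, 0)

/-- `Γⁱⱼₖ = - (∂²fⁱ/∂xˡ∂yᵐ) ḡˡⱼ g̃ᵐₖ`, with `ḡ`, `g̃` the inverses of `∂f/∂x`, `∂f/∂y`. -/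
def Gam (f : Pt → Fin 2 → ℝ) (i j k : Fin 2) (z : Pt) : ℝ :=
  -∑ l, ∑ m, mixed f i l m z * (dX f z)⁻¹ l j * (dY f z)⁻¹ m k

/-- The connection form `ωⱼⁱ = Γⁱₖⱼ ω₁ᵏ + Γⁱⱼₖ ω₂ᵏ` (lower index `j`, upper index `i`) at `z`,
evaluated on `v`. -/
def conn (f : Pt → Fin 2 → ℝ) (j i : Fin 2) (z v : Pt) : ℝ :=
  ∑ k, (Gam f i k j z * om1 f k z v + Gam f i j k z * om2 f k z v)

/-- The torsion tensor `aⁱⱼₖ = Γⁱ_[jk]`. -/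
def torsion (f : Pt → Fin 2 → ℝ) (i j k : Fin 2) (z : Pt) : ℝ :=
  (Gam f i j k z - Gam f i k j z) / 2

/-- The covector `a = (a₁, a₂)`, determined by `aⁱⱼₖ = a_[j δⁱ_k]`
(see `torsion_eq`); taking the trace gives `aⱼ = 2 aᵏⱼₖ`. -/
def cov (f : Pt → Fin 2 → ℝ) (j : Fin 2) (z : Pt) : ℝ := 2 * ∑ k, torsion f k j k z

/-- `aⁱⱼₖ = a_[j δⁱ_k]`. -/
theorem torsion_eq (f : Pt → Fin 2 → ℝ) (i j k : Fin 2) (z : Pt) :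
    torsion f i j k z =
      (cov f j z * (if k = i then 1 else 0) - cov f k z * (if j = i then 1 else 0)) / 2 := by
  fin_cases i <;> fin_cases j <;> fin_cases k <;>
    simp [cov, torsion, Fin.sum_univ_two] <;> ring

/-- The covariant differential `∇aᵢ = daᵢ - aⱼ ωᵢʲ` at `z`, evaluated on `v`. -/
def nablaCov (f : Pt → Fin 2 → ℝ) (i : Fin 2) (z v : Pt) : ℝ :=
  fderiv ℝ (cov f i) z v - ∑ j, cov f j z * conn f i j z v

/-- The Pfaffian derivatives `pᵢⱼ`: `∇aᵢ = pᵢⱼ ω₁ʲ + qᵢⱼ ω₂ʲ` (see `nablaCov_eq`). -/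
def pT (f : Pt → Fin 2 → ℝ) (i j : Fin 2) (z : Pt) : ℝ := nablaCov f i z (fr1 f j z)

/-- The Pfaffian derivatives `qᵢⱼ`. -/
def qT (f : Pt → Fin 2 → ℝ) (i j : Fin 2) (z : Pt) : ℝ := nablaCov f i z (fr2 f j z)

theorem conn_add (f : Pt → Fin 2 → ℝ) (j i : Fin 2) (z u v : Pt) :
    conn f j i z (u + v) = conn f j i z u + conn f j i z v := by
  simp [conn, om1, om2, Fin.sum_univ_two]; ring

theorem conn_smul (f : Pt → Fin 2 → ℝ) (j i : Fin 2) (z : Pt) (c : ℝ) (v : Pt) :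
    conn f j i z (c • v) = c * conn f j i z v := by
  simp [conn, om1, om2, Fin.sum_univ_two]; ring

/-- Every vector is expanded in the frame by means of the coframe. -/
theorem expand (f : Pt → Fin 2 → ℝ) (z v : Pt)
    (h1 : (dX f z).det ≠ 0) (h2 : (dY f z).det ≠ 0) :
    v = ∑ j, (om1 f j z v • fr1 f j z + om2 f j z v • fr2 f j z) := by
  have hX := Matrix.nonsing_inv_mul (dX f z) (isUnit_iff_ne_zero.mpr h1)
  have hY := Matrix.nonsing_inv_mul (dY f z) (isUnit_iff_ne_zero.mpr h2)
  have kX : ((dX f z)⁻¹).mulVec ((dX f z).mulVec v.1) = v.1 := by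
    rw [Matrix.mulVec_mulVec, hX, Matrix.one_mulVec]
  have kY : ((dY f z)⁻¹).mulVec ((dY f z).mulVec v.2) = v.2 := by
    rw [Matrix.mulVec_mulVec, hY, Matrix.one_mulVec]
  ext l
  · have := congrFun kX l
    simp only [Matrix.mulVec, dotProduct, Fin.sum_univ_two] at this
    simp [om1, om2, fr1, fr2, Fin.sum_univ_two]
    linarith
  · have := congrFun kY l
    simp only [Matrix.mulVec, dotProduct, Fin.sum_univ_two] at this
    simp [om1, om2, fr1, fr2, Fin.sum_univ_two]
    linarith

theorem nablaCov_eq (f : Pt → Fin 2 → ℝ) (i : Fin 2) (z v : Pt)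
    (h1 : (dX f z).det ≠ 0) (h2 : (dY f z).det ≠ 0) :
    nablaCov f i z v = ∑ j, (pT f i j z * om1 f j z v + qT f i j z * om2 f j z v) := by
  have e := expand f z v h1 h2
  have : nablaCov f i z v = nablaCov f i z
      (∑ j, (om1 f j z v • fr1 f j z + om2 f j z v • fr2 f j z)) := by rw [← e]
  rw [this]
  simp only [nablaCov, pT, qT, Fin.sum_univ_two, map_add, map_smul, conn_add, conn_smul,
    smul_eq_mul]
  ring

/-- `p = p_[12]`. -/
def pS (f : Pt → Fin 2 → ℝ) (z : Pt) : ℝ := (pT f 0 1 z - pT f 1 0 z) / 2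

/-- `q = q_[12]`. -/
def qS (f : Pt → Fin 2 → ℝ) (z : Pt) : ℝ := (qT f 0 1 z - qT f 1 0 z) / 2

/-- The curvature form `dωⱼⁱ - ωⱼᵏ ∧ ωₖⁱ` at `z`, evaluated on `(u, v)`. -/
def curvForm (f : Pt → Fin 2 → ℝ) (j i : Fin 2) (z u v : Pt) : ℝ :=
  fderiv ℝ (fun w => conn f j i w v) z u - fderiv ℝ (fun w => conn f j i w u) z v
    - ∑ k, (conn f j k z u * conn f k i z v - conn f j k z v * conn f k i z u)

/-- The curvature tensor `bⁱⱼₖₗ`: the coefficient of `ω₁ᵏ ∧ ω₂ˡ` in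
`dωⱼⁱ - ωⱼᵏ ∧ ωₖⁱ = bⁱⱼₖₗ ω₁ᵏ ∧ ω₂ˡ`. -/
def curv (f : Pt → Fin 2 → ℝ) (i j k l : Fin 2) (z : Pt) : ℝ :=
  curvForm f j i z (fr1 f k z) (fr2 f l z)

/-- The symmetric part `t_(jkl)`. -/
def sym3 (t : Fin 2 → Fin 2 → Fin 2 → ℝ) (j k l : Fin 2) : ℝ :=
  (t j k l + t j l k + t k j l + t k l j + t l j k + t l k j) / 6

/-- The web is not isoclinicly geodesic: `a ≠ 0`. -/
def NonIsoclinicGeodesic (f : Pt → Fin 2 → ℝ) (D : Set Pt) : Prop :=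
  ∀ z ∈ D, ∃ i, cov f i z ≠ 0

/-- The web is nonisoclinic: `p² + q² > 0`. -/
def NonIsoclinic (f : Pt → Fin 2 → ℝ) (D : Set Pt) : Prop :=
  ∀ z ∈ D, 0 < pS f z ^ 2 + qS f z ^ 2

/-- Analytic condition for group webs: the curvature tensor vanishes. -/
def CurvatureVanishes (f : Pt → Fin 2 → ℝ) (D : Set Pt) : Prop :=
  ∀ z ∈ D, ∀ i j k l, curv f i j k l z = 0

/-! ### Surfaces -/

/-- `Φ`, restricted to the open set `U`, is a smooth immersed parametrized surface in `D`. -/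
structure IsSurface (D : Set Pt) (U : Set (ℝ × ℝ)) (Φ : ℝ × ℝ → Pt) : Prop where
  isOpen : IsOpen U
  smooth : ContDiffOn ℝ ∞ Φ U
  mapsTo : ∀ u ∈ U, Φ u ∈ D
  immersion : ∀ u ∈ U, Function.Injective (fderiv ℝ Φ u)

/-- The tangent plane of a parametrized surface. -/
def tangentPlane (Φ : ℝ × ℝ → Pt) (u : ℝ × ℝ) : Set Pt := Set.range (fderiv ℝ Φ u)

/-- A surface in `D` that is tangent at each of its points to the distribution `P`. -/
structure IsIntegralSurface (D : Set Pt) (P : Pt → Set Pt) (U : Set (ℝ × ℝ))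
    (Φ : ℝ × ℝ → Pt) : Prop extends IsSurface D U Φ where
  tangent : ∀ u ∈ U, tangentPlane Φ u = P (Φ u)

/-- A distribution of planes is integrable on `D`: an integral surface passes through every
point of `D`. -/
def Integrable (D : Set Pt) (P : Pt → Set Pt) : Prop :=
  ∀ z ∈ D, ∃ (U : Set (ℝ × ℝ)) (Φ : ℝ × ℝ → Pt) (u : ℝ × ℝ),
    IsIntegralSurface D P U Φ ∧ u ∈ U ∧ Φ u = z

/-! ### Transversally geodesic webs -/

/-- The transversal bivector (plane) at `z` in the direction `ξ`:
`ξ² ω₁¹ - ξ¹ ω₁² = 0`, `ξ² ω₂¹ - ξ¹ ω₂² = 0`. -/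
def transversalPlane (f : Pt → Fin 2 → ℝ) (ξ : Fin 2 → ℝ) (z : Pt) : Set Pt :=
  {v | ξ 1 * om1 f 0 z v - ξ 0 * om1 f 1 z v = 0 ∧
    ξ 1 * om2 f 0 z v - ξ 0 * om2 f 1 z v = 0}

/-- The web is transversally geodesic: through every point and tangent to every transversal
bivector at this point there passes a surface whose tangent plane at each of its points
is a transversal bivector. (By the structure equations, such a surface is automatically totally
geodesic in the connection `ωⱼⁱ`.) -/
def TransversallyGeodesic (f : Pt → Fin 2 → ℝ) (D : Set Pt) : Prop :=
  ∀ z ∈ D, ∀ ξ : Fin 2 → ℝ, ξ ≠ 0 →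
    ∃ (U : Set (ℝ × ℝ)) (Φ : ℝ × ℝ → Pt) (u₀ : ℝ × ℝ),
      IsSurface D U Φ ∧ u₀ ∈ U ∧ Φ u₀ = z ∧ tangentPlane Φ u₀ = transversalPlane f ξ z ∧
      ∀ u ∈ U, ∃ η : Fin 2 → ℝ, η ≠ 0 ∧ tangentPlane Φ u = transversalPlane f η (Φ u)

/-- The analytic condition `bⁱ_(jkl) = δⁱ_(j b_kl)` for transversally geodesic webs. -/
def CurvatureTransversal (f : Pt → Fin 2 → ℝ) (D : Set Pt) : Prop :=
  ∀ z ∈ D, ∃ β : Fin 2 → Fin 2 → ℝ, ∀ i j k l,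
    sym3 (fun j k l => curv f i j k l z) j k l =
      sym3 (fun j k l => (if i = j then 1 else 0) * β k l) j k l

/-- Class **C**, nontransversally geodesic webs. Both the geometric property and the
analytic condition are required to fail. -/
structure ClassC (f : Pt → Fin 2 → ℝ) (D : Set Pt) : Prop where
  geometric : ¬ TransversallyGeodesic f D
  analytic : ¬ CurvatureTransversal f D

/-! ### The transversal `a`-distribution -/

/-- The transversal `a`-distribution `Δ`:
`a₁ ω₁¹ + a₂ ω₁² = 0`, `a₁ ω₂¹ + a₂ ω₂² = 0`. -/
def Delta (f : Pt → Fin 2 → ℝ) (z : Pt) : Set Pt :=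
  {v | ∑ i, cov f i z * om1 f i z v = 0 ∧ ∑ i, cov f i z * om2 f i z v = 0}

/-- The form `θⱼⁱ = ωⱼⁱ + aⁱⱼₖ (P ω₁ᵏ + Q ω₂ᵏ)` at `z`, evaluated on `v`; here `P, Q` are the
values at `z` of two arbitrary functions. -/
def theta (f : Pt → Fin 2 → ℝ) (P Q : ℝ) (j i : Fin 2) (z v : Pt) : ℝ :=
  conn f j i z v + ∑ k, torsion f i j k z * (P * om1 f k z v + Q * om2 f k z v)

/-- `ω₁ⁱ(∇_X V)` at `z`, for the connection given by `diag(θⱼⁱ, θⱼⁱ)`. -/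
def covDeriv1 (f : Pt → Fin 2 → ℝ) (P Q : ℝ) (V : Pt → Pt) (i : Fin 2) (z X : Pt) : ℝ :=
  fderiv ℝ (fun w => om1 f i w (V w)) z X + ∑ j, om1 f j z (V z) * theta f P Q j i z X

/-- `ω₂ⁱ(∇_X V)` at `z`, for the connection given by `diag(θⱼⁱ, θⱼⁱ)`. -/
def covDeriv2 (f : Pt → Fin 2 → ℝ) (P Q : ℝ) (V : Pt → Pt) (i : Fin 2) (z X : Pt) : ℝ :=
  fderiv ℝ (fun w => om2 f i w (V w)) z X + ∑ j, om2 f j z (V z) * theta f P Q j i z X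

/-- The integral surfaces of `Δ` are geodesicly parallel in every affine connection of the bundle
`diag(θⱼⁱ, θⱼⁱ)`: the distribution `Δ` of their tangent planes is parallel, that is,
`∇_X V` lies in `Δ` for every smooth section `V` of `Δ` and every vector `X`. -/
def GeodesiclyParallel (f : Pt → Fin 2 → ℝ) (D : Set Pt) : Prop :=
  ∀ (P Q : Pt → ℝ) (V : Pt → Pt), ContDiffOn ℝ ∞ V D → (∀ z ∈ D, V z ∈ Delta f z) →
    ∀ z ∈ D, ∀ X : Pt,
      ∑ i, cov f i z * covDeriv1 f (P z) (Q z) V i z X = 0 ∧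
      ∑ i, cov f i z * covDeriv2 f (P z) (Q z) V i z X = 0

/-- The two-dimensional three-web `W(3,2,1)` cut by the foliations `x = const`, `y = const`,
`f = const` on a parametrized surface is hexagonal: all sufficiently small hexagonal figures
close. In such a figure the vertices `A₁, A₄, A₇` lie on the leaf of the first foliation through
the centre `O`, `A₂, A₅` on the one of the second, `A₃, A₆` on the one of the third. -/
def HexagonalOn (f : Pt → Fin 2 → ℝ) (U : Set (ℝ × ℝ)) (Φ : ℝ × ℝ → Pt) : Prop :=
  ∀ u₀ ∈ U, ∃ W ∈ 𝓝 u₀, W ⊆ U ∧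
    ∀ O ∈ W, ∀ A₁ ∈ W, ∀ A₂ ∈ W, ∀ A₃ ∈ W, ∀ A₄ ∈ W, ∀ A₅ ∈ W, ∀ A₆ ∈ W, ∀ A₇ ∈ W,
      (Φ A₁).1 = (Φ O).1 →
      f (Φ A₂) = f (Φ A₁) → (Φ A₂).2 = (Φ O).2 →
      (Φ A₃).1 = (Φ A₂).1 → f (Φ A₃) = f (Φ O) →
      (Φ A₄).2 = (Φ A₃).2 → (Φ A₄).1 = (Φ O).1 →
      f (Φ A₅) = f (Φ A₄) → (Φ A₅).2 = (Φ O).2 →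
      (Φ A₆).1 = (Φ A₅).1 → f (Φ A₆) = f (Φ O) →
      (Φ A₇).2 = (Φ A₆).2 → (Φ A₇).1 = (Φ O).1 →
      A₇ = A₁

/-- Class **A₃**: nonisoclinic webs for which `Δ` is the distribution `ω₁² = ω₂² = 0` and is
integrable. Besides these geometric properties the analytic conditions `a₁ = 0`, `π₁² = 0`
(`π₁²` is the restriction of `ω₁²` to `ω_α^i = 0`) and `p₁₁ = q₁₁ = 0` are required. -/
structure ClassA3 (f : Pt → Fin 2 → ℝ) (D : Set Pt) : Prop where
  isWeb : IsWeb f D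
  cov_ne_zero : NonIsoclinicGeodesic f D
  nonIsoclinic : NonIsoclinic f D
  delta_eq : ∀ z ∈ D, Delta f z = {v | om1 f 1 z v = 0 ∧ om2 f 1 z v = 0}
  integrable : Integrable D (Delta f)
  cov_zero : ∀ z ∈ D, cov f 0 z = 0
  pi_zero : ∀ z ∈ D, ∀ v, (∀ i, om1 f i z v = 0 ∧ om2 f i z v = 0) → conn f 0 1 z v = 0
  pT_zero : ∀ z ∈ D, pT f 0 0 z = 0
  qT_zero : ∀ z ∈ D, qT f 0 0 z = 0

/-- Class **A₃₁**: webs of class **A₃** for which the integral surfaces of `Δ` are geodesicly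
parallel; the analytic condition `p₁ᵢ = q₁ᵢ = 0` is required as well. -/
structure ClassA31 (f : Pt → Fin 2 → ℝ) (D : Set Pt) : Prop extends ClassA3 f D where
  geodesiclyParallel : GeodesiclyParallel f D
  p1 : ∀ z ∈ D, ∀ i, pT f 0 i z = 0
  q1 : ∀ z ∈ D, ∀ i, qT f 0 i z = 0

/-- Class **A₃₂**: webs of class **A₃** foliated into two-dimensional hexagonal webs cut on
the integral surfaces of `Δ`; the analytic condition `b¹₁₁₁ = b²₁₁₁ = 0` is required as well. -/
structure ClassA32 (f : Pt → Fin 2 → ℝ) (D : Set Pt) : Prop extends ClassA3 f D where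
  hexagonal : ∀ (U : Set (ℝ × ℝ)) (Φ : ℝ × ℝ → Pt),
    IsIntegralSurface D (Delta f) U Φ → HexagonalOn f U Φ
  curv_zero : ∀ z ∈ D, ∀ i, curv f i 0 0 0 z = 0

/-- Class **E₃₂₁**: `p₁ᵢ = q₁ᵢ = 0`, `p₂₁ = q₂₁`, `p₂₂ = 0`. -/
structure ClassE321 (f : Pt → Fin 2 → ℝ) (D : Set Pt) : Prop where
  p1 : ∀ z ∈ D, ∀ i, pT f 0 i z = 0
  q1 : ∀ z ∈ D, ∀ i, qT f 0 i z = 0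
  p21 : ∀ z ∈ D, pT f 1 0 z = qT f 1 0 z
  p22 : ∀ z ∈ D, pT f 1 1 z = 0

/-- Class **G₃**: `p = q ≠ 0`. -/
def ClassG3 (f : Pt → Fin 2 → ℝ) (D : Set Pt) : Prop :=
  ∀ z ∈ D, pS f z = qS f z ∧ pS f z ≠ 0

/-- The web `u₃¹ = y² exp(x¹ y¹)`, `u₃² = x² + y²` (superscripts are indices). -/
def expWeb (z : Pt) : Fin 2 → ℝ :=
  ![z.2 1 * Real.exp (z.1 0 * z.2 0), z.1 1 + z.2 1]

end Web322

end

namespace Web322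

/-! The second component of the web function is linear and the first does not involve x², so the
connection is triangular: Γ²ⱼₖ = 0, hence ωⱼ² = 0, while ω₁¹ = -d(log|x¹y¹y²| + x¹y¹) and ω₂¹ =
e^{x¹y¹} dx¹/x¹. The torsion then gives a₁ = 0 and a₂ = -1/(x¹y¹y²), so that ∇a₁ = 0, ∇a₂ = da₂, and
all pᵢⱼ, qᵢⱼ needed are explicit. Since ω₁¹ is exact, only the curvature form of ω₂¹ survives
(`curvForm_one_zero`), and b¹₂₁₁ ≠ 0.

The distribution Δ is dx² = dy² = 0. On its leaves the web function depends only on x¹y¹, so the web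
cut there is that of multiplication of real numbers; commutativity and associativity close the
hexagons (`hexagonalOn_expWeb`).

The tensor condition fails by pure index algebra (`not_curvatureTransversal`). The geometric
condition is refuted independently: a surface of transversal planes through the direction (1, 1) is
locally a graph x¹ = σ(x²), y¹ = τ(y²), and transversality forces y²(τσ' - στ') = 1, which is
impossible (`not_separated`). -/

/-- The set on which `expWeb` is a web and all its invariants are given by rational expressions. -/
def regularSet : Set Pt := {z | z.1 0 ≠ 0 ∧ z.2 0 ≠ 0 ∧ z.2 1 ≠ 0}

theorem isOpen_regularSet : IsOpen regularSet := by
  refine IsOpen.inter ?_ (IsOpen.inter ?_ ?_)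
  · exact isOpen_ne_fun (by fun_prop) (by fun_prop)
  · exact isOpen_ne_fun (by fun_prop) (by fun_prop)
  · exact isOpen_ne_fun (by fun_prop) (by fun_prop)

/-! ### Coordinate differentials, Jacobian matrices and their inverses. -/

/-- The differential of `xⁱ`. -/
noncomputable def dx (i : Fin 2) : Pt →L[ℝ] ℝ :=
  (ContinuousLinearMap.proj i).comp (ContinuousLinearMap.fst ℝ (Fin 2 → ℝ) (Fin 2 → ℝ))

/-- The differential of `yⁱ`. -/
noncomputable def dy (i : Fin 2) : Pt →L[ℝ] ℝ :=
  (ContinuousLinearMap.proj i).comp (ContinuousLinearMap.snd ℝ (Fin 2 → ℝ) (Fin 2 → ℝ))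

@[simp] theorem dx_apply (i : Fin 2) (v : Pt) : dx i v = v.1 i := rfl

@[simp] theorem dy_apply (i : Fin 2) (v : Pt) : dy i v = v.2 i := rfl

theorem hasFDerivAt_x (i : Fin 2) (z : Pt) : HasFDerivAt (fun w : Pt => w.1 i) (dx i) z :=
  (dx i).hasFDerivAt

theorem hasFDerivAt_y (i : Fin 2) (z : Pt) : HasFDerivAt (fun w : Pt => w.2 i) (dy i) z :=
  (dy i).hasFDerivAt

theorem hasFDerivAt_exp_mul (z : Pt) :
    HasFDerivAt (fun w : Pt => Real.exp (w.1 0 * w.2 0))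
      (Real.exp (z.1 0 * z.2 0) • (z.1 0 • dy 0 + z.2 0 • dx 0)) z :=
  ((hasFDerivAt_x 0 z).mul (hasFDerivAt_y 0 z)).exp

theorem contDiff_expWeb : ContDiff ℝ ∞ expWeb := by
  rw [contDiff_pi]
  intro i
  fin_cases i <;> simp only [expWeb, Fin.zero_eta, Fin.mk_one, Matrix.cons_val_zero,
    Matrix.cons_val_one] <;> fun_prop

theorem fderiv_expWeb_zero (z v : Pt) :
    fderiv ℝ expWeb z v 0 =
      Real.exp (z.1 0 * z.2 0) * (z.2 1 * (z.1 0 * v.2 0 + z.2 0 * v.1 0) + v.2 1) := by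
  have h := hasFDerivAt_pi'.1 (contDiff_expWeb.differentiable (by simp) z).hasFDerivAt 0
  have h' := h.unique ((hasFDerivAt_y 1 z).mul (hasFDerivAt_exp_mul z))
  have := congrArg (fun l : Pt →L[ℝ] ℝ => l v) h'
  simp at this
  rw [this]; ring

theorem fderiv_expWeb_one (z v : Pt) : fderiv ℝ expWeb z v 1 = v.1 1 + v.2 1 := by
  have h := hasFDerivAt_pi'.1 (contDiff_expWeb.differentiable (by simp) z).hasFDerivAt 1
  have h' := h.unique ((hasFDerivAt_x 1 z).add (hasFDerivAt_y 1 z))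
  have := congrArg (fun l : Pt →L[ℝ] ℝ => l v) h'
  simpa using this

theorem dX_expWeb (z : Pt) :
    dX expWeb z = !![Real.exp (z.1 0 * z.2 0) * z.2 1 * z.2 0, 0; 0, 1] := by
  ext i j
  fin_cases i <;> fin_cases j <;>
    simp [dX, fderiv_expWeb_zero, fderiv_expWeb_one, mul_assoc]

theorem dY_expWeb (z : Pt) :
    dY expWeb z = !![Real.exp (z.1 0 * z.2 0) * z.2 1 * z.1 0, Real.exp (z.1 0 * z.2 0); 0, 1] := by
  ext i j
  fin_cases i <;> fin_cases j <;>
    simp [dY, fderiv_expWeb_zero, fderiv_expWeb_one, mul_assoc]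

theorem inv_dX_expWeb {z : Pt} (hz : z ∈ regularSet) :
    (dX expWeb z)⁻¹ = !![(Real.exp (z.1 0 * z.2 0) * z.2 1 * z.2 0)⁻¹, 0; 0, 1] := by
  obtain ⟨h1, h2, h3⟩ := hz
  apply Matrix.inv_eq_right_inv
  rw [dX_expWeb]
  ext i j
  fin_cases i <;> fin_cases j <;> simp [Matrix.mul_apply, Fin.sum_univ_two]
  field_simp

theorem inv_dY_expWeb {z : Pt} (hz : z ∈ regularSet) :
    (dY expWeb z)⁻¹ =
      !![(Real.exp (z.1 0 * z.2 0) * z.2 1 * z.1 0)⁻¹, -(z.2 1 * z.1 0)⁻¹; 0, 1] := by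
  obtain ⟨h1, h2, h3⟩ := hz
  apply Matrix.inv_eq_right_inv
  rw [dY_expWeb]
  ext i j
  fin_cases i <;> fin_cases j <;> simp [Matrix.mul_apply, Fin.sum_univ_two]
  all_goals field_simp
  all_goals ring

theorem isWeb_expWeb {D : Set Pt} (hD : IsOpen D) (hsub : D ⊆ regularSet) : IsWeb expWeb D where
  isOpen := hD
  smooth := contDiff_expWeb.contDiffOn
  det_dX z hz := by
    obtain ⟨h1, h2, h3⟩ := hsub hz
    simp [dX_expWeb, Matrix.det_fin_two, h2, h3]
  det_dY z hz := by
    obtain ⟨h1, h2, h3⟩ := hsub hz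
    simp [dY_expWeb, Matrix.det_fin_two, h1, h3]

/-! ### Coframe, connection coefficients, torsion covector and frame. -/

theorem om1_zero (z v : Pt) :
    om1 expWeb 0 z v = Real.exp (z.1 0 * z.2 0) * z.2 1 * z.2 0 * v.1 0 := by
  simp [om1, dX_expWeb, Fin.sum_univ_two]

theorem om1_one (z v : Pt) : om1 expWeb 1 z v = v.1 1 := by
  simp [om1, dX_expWeb, Fin.sum_univ_two]

theorem om2_zero (z v : Pt) :
    om2 expWeb 0 z v = Real.exp (z.1 0 * z.2 0) * (z.2 1 * z.1 0 * v.2 0 + v.2 1) := by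
  simp [om2, dY_expWeb, Fin.sum_univ_two]; ring

theorem om2_one (z v : Pt) : om2 expWeb 1 z v = v.2 1 := by
  simp [om2, dY_expWeb, Fin.sum_univ_two]

theorem hasFDerivAt_dY_zero_zero (z : Pt) :
    HasFDerivAt (fun w => dY expWeb w 0 0)
      ((Real.exp (z.1 0 * z.2 0) * z.2 1) • dx 0 + z.1 0 • (Real.exp (z.1 0 * z.2 0) • dy 1
        + z.2 1 • Real.exp (z.1 0 * z.2 0) • (z.1 0 • dy 0 + z.2 0 • dx 0))) z := by
  simpa [dY_expWeb] using
    ((hasFDerivAt_exp_mul z).fun_mul (hasFDerivAt_y 1 z)).fun_mul (hasFDerivAt_x 0 z)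

theorem hasFDerivAt_dY_zero_one (z : Pt) :
    HasFDerivAt (fun w => dY expWeb w 0 1)
      (Real.exp (z.1 0 * z.2 0) • (z.1 0 • dy 0 + z.2 0 • dx 0)) z := by
  simpa [dY_expWeb] using hasFDerivAt_exp_mul z

theorem mixed_zero_zero_zero (z : Pt) :
    mixed expWeb 0 0 0 z = Real.exp (z.1 0 * z.2 0) * z.2 1 * (1 + z.1 0 * z.2 0) := by
  rw [mixed, (hasFDerivAt_dY_zero_zero z).fderiv]
  simp
  ring

theorem mixed_zero_zero_one (z : Pt) :
    mixed expWeb 0 0 1 z = Real.exp (z.1 0 * z.2 0) * z.2 0 := by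
  simp [mixed, (hasFDerivAt_dY_zero_one z).fderiv]

theorem mixed_zero_one (m : Fin 2) (z : Pt) : mixed expWeb 0 1 m z = 0 := by
  fin_cases m
  · simp [mixed, (hasFDerivAt_dY_zero_zero z).fderiv]
  · simp [mixed, (hasFDerivAt_dY_zero_one z).fderiv]

theorem mixed_one (l m : Fin 2) (z : Pt) : mixed expWeb 1 l m z = 0 := by
  fin_cases m <;> simp [mixed, dY_expWeb]

theorem Gam_one (j k : Fin 2) (z : Pt) : Gam expWeb 1 j k z = 0 := by
  simp [Gam, mixed_one]

theorem Gam_zero_one (k : Fin 2) {z : Pt} (hz : z ∈ regularSet) : Gam expWeb 0 1 k z = 0 := by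
  simp [Gam, Fin.sum_univ_two, mixed_zero_one, inv_dX_expWeb hz]

theorem Gam_zero_zero_zero {z : Pt} (hz : z ∈ regularSet) :
    Gam expWeb 0 0 0 z =
      -(1 + z.1 0 * z.2 0) / (Real.exp (z.1 0 * z.2 0) * z.1 0 * z.2 0 * z.2 1) := by
  have ⟨h1, h2, h3⟩ := hz
  simp [Gam, Fin.sum_univ_two, mixed_zero_one, mixed_zero_zero_zero,
    inv_dX_expWeb hz, inv_dY_expWeb hz]
  field_simp
  ring

theorem Gam_zero_zero_one {z : Pt} (hz : z ∈ regularSet) :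
    Gam expWeb 0 0 1 z = (z.1 0 * z.2 0 * z.2 1)⁻¹ := by
  have ⟨h1, h2, h3⟩ := hz
  simp [Gam, Fin.sum_univ_two, mixed_zero_one, mixed_zero_zero_zero, mixed_zero_zero_one,
    inv_dX_expWeb hz, inv_dY_expWeb hz]
  field_simp
  ring

theorem torsion_one (j k : Fin 2) (z : Pt) : torsion expWeb 1 j k z = 0 := by
  simp [torsion, Gam_one]

theorem cov_zero_expWeb (z : Pt) : cov expWeb 0 z = 0 := by
  simp [cov, torsion, Fin.sum_univ_two, Gam_one]

theorem cov_one_expWeb {z : Pt} (hz : z ∈ regularSet) :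
    cov expWeb 1 z = -(z.1 0 * z.2 0 * z.2 1)⁻¹ := by
  simp [cov, torsion, Fin.sum_univ_two, Gam_one, Gam_zero_zero_one hz, Gam_zero_one _ hz]
  ring

theorem cov_one_ne_zero {z : Pt} (hz : z ∈ regularSet) : cov expWeb 1 z ≠ 0 := by
  have ⟨h1, h2, h3⟩ := hz
  simp [cov_one_expWeb hz, h1, h2, h3]

theorem conn_one (j : Fin 2) (z v : Pt) : conn expWeb j 1 z v = 0 := by
  simp [conn, Gam_one]

/-- The form is exact, namely -d(log|x¹y¹y²| + x¹y¹); this is why its curvature will vanish. -/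
theorem conn_zero_zero {z : Pt} (hz : z ∈ regularSet) (v : Pt) :
    conn expWeb 0 0 z v = -(((z.1 0)⁻¹ + z.2 0) * v.1 0 + ((z.2 0)⁻¹ + z.1 0) * v.2 0
      + (z.2 1)⁻¹ * v.2 1) := by
  have ⟨h1, h2, h3⟩ := hz
  simp [conn, Fin.sum_univ_two, Gam_zero_one _ hz, Gam_zero_zero_zero hz, Gam_zero_zero_one hz,
    om1_zero, om2_zero, om2_one]
  field_simp
  ring

theorem conn_one_zero {z : Pt} (hz : z ∈ regularSet) (v : Pt) :
    conn expWeb 1 0 z v = Real.exp (z.1 0 * z.2 0) * (z.1 0)⁻¹ * v.1 0 := by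
  have ⟨h1, h2, h3⟩ := hz
  simp [conn, Fin.sum_univ_two, Gam_zero_one _ hz, Gam_zero_zero_one hz, om1_zero]
  field_simp

theorem fr1_zero {z : Pt} (hz : z ∈ regularSet) :
    fr1 expWeb 0 z = (![(Real.exp (z.1 0 * z.2 0) * z.2 1 * z.2 0)⁻¹, 0], 0) := by
  ext i <;> fin_cases i <;> simp [fr1, inv_dX_expWeb hz]

theorem fr1_one {z : Pt} (hz : z ∈ regularSet) : fr1 expWeb 1 z = (![0, 1], 0) := by
  ext i <;> fin_cases i <;> simp [fr1, inv_dX_expWeb hz]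

theorem fr2_zero {z : Pt} (hz : z ∈ regularSet) :
    fr2 expWeb 0 z = (0, ![(Real.exp (z.1 0 * z.2 0) * z.2 1 * z.1 0)⁻¹, 0]) := by
  ext i <;> fin_cases i <;> simp [fr2, inv_dY_expWeb hz]

/-! ### Covariant differential of a and the quantities p, q. -/

theorem nablaCov_zero (z v : Pt) : nablaCov expWeb 0 z v = 0 := by
  have : cov expWeb 0 = fun _ => 0 := funext cov_zero_expWeb
  simp [nablaCov, Fin.sum_univ_two, this, conn_one]

/-- Both correction terms drop out (a₁ = 0 and ω₂² = 0), leaving da₂ = -a₂ d log|x¹y¹y²|. -/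
theorem nablaCov_one {z : Pt} (hz : z ∈ regularSet) (v : Pt) :
    nablaCov expWeb 1 z v = (z.1 0 * z.2 0 * z.2 1)⁻¹ *
      ((z.1 0)⁻¹ * v.1 0 + (z.2 0)⁻¹ * v.2 0 + (z.2 1)⁻¹ * v.2 1) := by
  have ⟨h1, h2, h3⟩ := hz
  -- The closed formula for a₂ is known only on `regularSet`; openness makes it an identity of
  -- germs, which may be differentiated.
  have h : HasFDerivAt (cov expWeb 1) _ z :=
    (HasFDerivAt.fun_neg ((hasDerivAt_inv (by simp [h1, h2, h3])).comp_hasFDerivAt z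
      (((hasFDerivAt_x 0 z).mul (hasFDerivAt_y 0 z)).mul (hasFDerivAt_y 1 z)))
      ).congr_of_eventuallyEq
      (Filter.eventuallyEq_of_mem (isOpen_regularSet.mem_nhds hz) fun w hw => cov_one_expWeb hw)
  rw [nablaCov, h.fderiv]
  simp [Fin.sum_univ_two, cov_zero_expWeb, conn_one]
  field_simp

theorem pT_zero_expWeb (j : Fin 2) (z : Pt) : pT expWeb 0 j z = 0 := nablaCov_zero _ _

theorem qT_zero_expWeb (j : Fin 2) (z : Pt) : qT expWeb 0 j z = 0 := nablaCov_zero _ _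

theorem pT_one_zero {z : Pt} (hz : z ∈ regularSet) :
    pT expWeb 1 0 z =
      (Real.exp (z.1 0 * z.2 0))⁻¹ * ((z.1 0 * z.2 0 * z.2 1) ^ 2)⁻¹ := by
  have ⟨h1, h2, h3⟩ := hz
  simp [pT, nablaCov_one hz, fr1_zero hz]
  field_simp

/-- The value agrees with p₂₁ because e₁₁ and e₂₁ change log|x¹y¹y²| at the same rate
1/(e^{x¹y¹}x¹y¹y²), x¹ and y¹ entering symmetrically. -/
theorem qT_one_zero {z : Pt} (hz : z ∈ regularSet) :
    qT expWeb 1 0 z =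
      (Real.exp (z.1 0 * z.2 0))⁻¹ * ((z.1 0 * z.2 0 * z.2 1) ^ 2)⁻¹ := by
  have ⟨h1, h2, h3⟩ := hz
  simp [qT, nablaCov_one hz, fr2_zero hz]
  field_simp

theorem pT_one_one {z : Pt} (hz : z ∈ regularSet) : pT expWeb 1 1 z = 0 := by
  simp [pT, nablaCov_one hz, fr1_one hz]

theorem pS_ne_zero {z : Pt} (hz : z ∈ regularSet) : pS expWeb z ≠ 0 := by
  have ⟨h1, h2, h3⟩ := hz
  simp [pS, pT_zero_expWeb, pT_one_zero hz, h1, h2, h3]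

theorem pS_eq_qS {z : Pt} (hz : z ∈ regularSet) : pS expWeb z = qS expWeb z := by
  simp [pS, qS, pT_zero_expWeb, qT_zero_expWeb, pT_one_zero hz, qT_one_zero hz]

/-! ### Curvature and failure of the tensor condition. -/

theorem curvForm_one (j : Fin 2) (z u v : Pt) : curvForm expWeb j 1 z u v = 0 := by
  simp [curvForm, conn_one]

theorem fderiv_conn_zero_zero {z : Pt} (hz : z ∈ regularSet) (u v : Pt) :
    fderiv ℝ (fun w => conn expWeb 0 0 w v) z u =
      ((z.1 0 ^ 2)⁻¹ * u.1 0 - u.2 0) * v.1 0 + ((z.2 0 ^ 2)⁻¹ * u.2 0 - u.1 0) * v.2 0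
      + (z.2 1 ^ 2)⁻¹ * u.2 1 * v.2 1 := by
  have ⟨h1, h2, h3⟩ := hz
  have e1 := (hasDerivAt_inv h1).comp_hasFDerivAt z (hasFDerivAt_x 0 z)
  have e2 := (hasDerivAt_inv h2).comp_hasFDerivAt z (hasFDerivAt_y 0 z)
  have e3 := (hasDerivAt_inv h3).comp_hasFDerivAt z (hasFDerivAt_y 1 z)
  have h : HasFDerivAt (fun w => conn expWeb 0 0 w v) _ z :=
    ((((e1.add (hasFDerivAt_y 0 z)).mul_const (v.1 0)).add
      ((e2.add (hasFDerivAt_x 0 z)).mul_const (v.2 0))).add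
      (e3.mul_const (v.2 1))).neg.congr_of_eventuallyEq
      (Filter.eventuallyEq_of_mem (isOpen_regularSet.mem_nhds hz) fun w hw => conn_zero_zero hw v)
  rw [h.fderiv]
  simp
  ring

theorem fderiv_conn_one_zero {z : Pt} (hz : z ∈ regularSet) (u v : Pt) :
    fderiv ℝ (fun w => conn expWeb 1 0 w v) z u =
      Real.exp (z.1 0 * z.2 0) *
        (u.2 0 + z.2 0 * (z.1 0)⁻¹ * u.1 0 - (z.1 0 ^ 2)⁻¹ * u.1 0) * v.1 0 := by
  have ⟨h1, h2, h3⟩ := hz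
  have e1 := (hasDerivAt_inv h1).comp_hasFDerivAt z (hasFDerivAt_x 0 z)
  have h : HasFDerivAt (fun w => conn expWeb 1 0 w v) _ z :=
    (((hasFDerivAt_exp_mul z).mul e1).mul_const (v.1 0)).congr_of_eventuallyEq
      (Filter.eventuallyEq_of_mem (isOpen_regularSet.mem_nhds hz) fun w hw => conn_one_zero hw v)
  rw [h.fderiv]
  simp
  field_simp
  ring

/-- ω₁¹ is closed, and the quadratic term reduces to ω₁¹ ∧ ω₁¹ = 0 because ω₁² = 0. -/
theorem curvForm_zero_zero {z : Pt} (hz : z ∈ regularSet) (u v : Pt) :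
    curvForm expWeb 0 0 z u v = 0 := by
  rw [curvForm, fderiv_conn_zero_zero hz, fderiv_conn_zero_zero hz]
  simp [Fin.sum_univ_two, conn_one]
  ring

/-- Since ω₂² = 0, the form is dω₂¹ - ω₂¹ ∧ ω₁¹; here dω₂¹ = e^{x¹y¹} dy¹ ∧ dx¹ cancels the
contribution of the x¹dy¹ part of ω₁¹. -/
theorem curvForm_one_zero {z : Pt} (hz : z ∈ regularSet) (u v : Pt) :
    curvForm expWeb 1 0 z u v = Real.exp (z.1 0 * z.2 0) * (z.1 0)⁻¹ *
      ((z.2 0)⁻¹ * (u.1 0 * v.2 0 - v.1 0 * u.2 0)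
        + (z.2 1)⁻¹ * (u.1 0 * v.2 1 - v.1 0 * u.2 1)) := by
  have ⟨h1, h2, h3⟩ := hz
  rw [curvForm, fderiv_conn_one_zero hz, fderiv_conn_one_zero hz]
  simp [Fin.sum_univ_two, conn_one, conn_zero_zero hz, conn_one_zero hz]
  field_simp
  ring

theorem curv_one (j k l : Fin 2) (z : Pt) : curv expWeb 1 j k l z = 0 := curvForm_one _ _ _ _

theorem curv_zero_zero (k l : Fin 2) {z : Pt} (hz : z ∈ regularSet) :
    curv expWeb 0 0 k l z = 0 := curvForm_zero_zero hz _ _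

theorem curv_zero_one_zero_zero_ne_zero {z : Pt} (hz : z ∈ regularSet) :
    curv expWeb 0 1 0 0 z ≠ 0 := by
  have ⟨h1, h2, h3⟩ := hz
  simp [curv, curvForm_one_zero hz, fr1_zero hz, fr2_zero hz, h1, h2, h3]

theorem not_curvatureTransversal {D : Set Pt} (hne : D.Nonempty) (hsub : D ⊆ regularSet) :
    ¬ CurvatureTransversal expWeb D := by
  intro h
  obtain ⟨z, hz⟩ := hne
  obtain ⟨β, hβ⟩ := h z hz
  have hz := hsub hz
  -- As b² = 0, the component (i; jkl) = (2; 122) gives β₁₂ + β₂₁ = 0. In (1; 112) only b¹₂₁₁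
  -- survives on the left, and the right side is a multiple of β₁₂ + β₂₁.
  have e1 := hβ 1 0 1 1
  have e2 := hβ 0 0 0 1
  simp [sym3, curv_one] at e1
  simp [sym3, curv_zero_zero _ _ hz] at e2
  apply curv_zero_one_zero_zero_ne_zero hz
  linarith

theorem mem_Delta_iff {z : Pt} (hz : z ∈ regularSet) (v : Pt) :
    v ∈ Delta expWeb z ↔ v.1 1 = 0 ∧ v.2 1 = 0 := by
  simp [Delta, Fin.sum_univ_two, cov_zero_expWeb, cov_one_ne_zero hz, om1_one, om2_one]

/-! ### Surfaces as local graphs. -/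

theorem IsSurface.contDiffAt {D : Set Pt} {U : Set (ℝ × ℝ)} {Φ : ℝ × ℝ → Pt}
    (h : IsSurface D U Φ) {u : ℝ × ℝ} (hu : u ∈ U) : ContDiffAt ℝ ∞ Φ u :=
  h.smooth.contDiffAt (h.isOpen.mem_nhds hu)

/-- A linear map that is injective on the tangent plane restricts to a local chart. -/
theorem IsSurface.exists_equiv {D : Set Pt} {U : Set (ℝ × ℝ)} {Φ : ℝ × ℝ → Pt}
    (h : IsSurface D U Φ) {u : ℝ × ℝ} (hu : u ∈ U) (π : Pt →L[ℝ] ℝ × ℝ)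
    (hπ : ∀ v ∈ tangentPlane Φ u, π v = 0 → v = 0) :
    ∃ e : (ℝ × ℝ) ≃L[ℝ] (ℝ × ℝ),
      HasFDerivAt (fun w => π (Φ w)) (e : (ℝ × ℝ) →L[ℝ] (ℝ × ℝ)) u := by
  have hd : HasFDerivAt (fun w => π (Φ w)) (π.comp (fderiv ℝ Φ u)) u :=
    π.hasFDerivAt.comp u ((h.contDiffAt hu).differentiableAt (by simp)).hasFDerivAt
  have hinj : Function.Injective (π.comp (fderiv ℝ Φ u)).toLinearMap := by
    rw [← LinearMap.ker_eq_bot, LinearMap.ker_eq_bot']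
    intro v hv
    have h0 : fderiv ℝ Φ u v = 0 := hπ _ ⟨v, rfl⟩ hv
    exact h.immersion u hu (by rw [h0, map_zero])
  refine ⟨(LinearEquiv.ofInjectiveEndo _ hinj).toContinuousLinearEquiv, ?_⟩
  convert hd using 1
  ext <;> rfl

/-- Near each of its points a surface is a graph over any plane to which its tangent plane
projects injectively. -/
theorem IsSurface.exists_graph {D : Set Pt} {U : Set (ℝ × ℝ)} {Φ : ℝ × ℝ → Pt}
    (h : IsSurface D U Φ) {u : ℝ × ℝ} (hu : u ∈ U) (π : Pt →L[ℝ] ℝ × ℝ)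
    (hπ : ∀ v ∈ tangentPlane Φ u, π v = 0 → v = 0) :
    ∃ g : ℝ × ℝ → ℝ × ℝ, g (π (Φ u)) = u ∧ ∀ᶠ y in 𝓝 (π (Φ u)),
      g y ∈ U ∧ π (Φ (g y)) = y ∧ DifferentiableAt ℝ (fun x => Φ (g x)) y ∧
      ∀ v, fderiv ℝ (fun x => Φ (g x)) y v ∈ tangentPlane Φ (g y) ∧
        π (fderiv ℝ (fun x => Φ (g x)) y v) = v := by
  obtain ⟨e, he⟩ := h.exists_equiv hu π hπ
  have hc : ContDiffAt ℝ 1 (fun w => π (Φ w)) u :=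
    π.contDiff.contDiffAt.comp u ((h.contDiffAt hu).of_le (by simp))
  have hs := hc.hasStrictFDerivAt' he one_ne_zero
  have hg : ContDiffAt ℝ 1 (hs.localInverse _ _ _) (π (Φ u)) :=
    hc.to_localInverse he one_ne_zero
  have hgu : hs.localInverse _ _ _ (π (Φ u)) = u := hs.localInverse_apply_image
  refine ⟨hs.localInverse _ _ _, hgu, ?_⟩
  have hU : ∀ᶠ y in 𝓝 (π (Φ u)), hs.localInverse _ _ _ y ∈ U :=
    hs.localInverse_tendsto.eventually (h.isOpen.mem_nhds hu)
  -- The right-inverse identity is needed both at y and on a neighbourhood of y, the latter in order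
  -- to differentiate it there.
  filter_upwards [hU, hs.eventually_right_inverse, hs.eventually_right_inverse.eventually_nhds,
    hg.eventually (by simp)] with y hyU hy hy' hgy
  have hdg := (hgy.differentiableAt one_ne_zero).hasFDerivAt
  have hdΦ := ((h.contDiffAt hyU).differentiableAt (by simp)).hasFDerivAt
  have hd := hdΦ.comp y hdg
  refine ⟨hyU, hy, hd.differentiableAt, fun v => ?_⟩
  have hd' : fderiv ℝ (fun x => Φ (hs.localInverse _ _ _ x)) y = _ := hd.fderiv
  refine ⟨?_, ?_⟩
  · rw [hd']
    exact ⟨_, rfl⟩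
  · have h1 : HasFDerivAt (fun x => π (Φ (hs.localInverse _ _ _ x))) _ y :=
      π.hasFDerivAt.comp y hd.differentiableAt.hasFDerivAt
    have h2 := h1.unique ((hasFDerivAt_id y).congr_of_eventuallyEq hy')
    exact congrArg (fun l : (ℝ × ℝ) →L[ℝ] (ℝ × ℝ) => l v) h2

/-! ### Failure of transversal geodesicity. -/

/-- The equation `w (τ(w) σ'(x) - σ(x) τ'(w)) = 1` has no solutions with `τ(w₀) ≠ 0`
and `σ'(x₀) ≠ 0`. -/
theorem not_separated {σ τ σ' τ' : ℝ → ℝ} {x₀ w₀ r : ℝ} (hr : 0 < r)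
    (hσ : HasDerivAt σ (σ' x₀) x₀)
    (hτ : ∀ w ∈ Metric.ball w₀ r, HasDerivAt τ (τ' w) w)
    (hτ0 : τ w₀ ≠ 0) (hσ' : σ' x₀ ≠ 0)
    (heq : ∀ x ∈ Metric.ball x₀ r, ∀ w ∈ Metric.ball w₀ r,
      w * τ w * σ' x = w * σ x * τ' w + 1) : False := by
  have hx₀ := Metric.mem_ball_self (x := x₀) hr
  have hw₀ := Metric.mem_ball_self (x := w₀) hr
  -- Two values x, x₀ give a linear system for wτ(w) and wτ'(w). If its determinant vanishes for
  -- every x, elimination makes σ constant; otherwise both unknowns are constant in w.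
  by_cases hD : ∀ x ∈ Metric.ball x₀ r, σ' x * σ x₀ = σ x * σ' x₀
  · have hconst : ∀ x ∈ Metric.ball x₀ r, σ x = σ x₀ := by
      intro x hx
      have e1 := heq x hx w₀ hw₀
      have e2 := heq x₀ hx₀ w₀ hw₀
      linear_combination -σ x * e2 + σ x₀ * e1 - w₀ * τ w₀ * hD x hx
    have h0 : HasDerivAt σ 0 x₀ := (hasDerivAt_const x₀ (σ x₀)).congr_of_eventuallyEq
      (Filter.eventuallyEq_of_mem (Metric.ball_mem_nhds _ hr) hconst)
    exact hσ' (hσ.unique h0)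
  · push Not at hD
    obtain ⟨x, hx, hD⟩ := hD
    have hD := sub_ne_zero.2 hD
    set d := σ' x * σ x₀ - σ x * σ' x₀
    have e1 : ∀ w ∈ Metric.ball w₀ r, w * τ w = (σ x₀ - σ x) / d := by
      intro w hw
      rw [eq_div_iff hD]
      linear_combination σ x₀ * heq x hx w hw - σ x * heq x₀ hx₀ w hw
    have e2 : ∀ w ∈ Metric.ball w₀ r, w * τ' w = (σ' x₀ - σ' x) / d := by
      intro w hw
      rw [eq_div_iff hD]
      linear_combination σ' x₀ * heq x hx w hw - σ' x * heq x₀ hx₀ w hw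
    -- Differentiating the constant wτ gives τ = -wτ', so τ itself is constant; then τ' = 0 and so τ
    -- = 0.
    have e3 : ∀ w ∈ Metric.ball w₀ r, τ w = -((σ' x₀ - σ' x) / d) := by
      intro w hw
      have h0 := (hasDerivAt_const w ((σ x₀ - σ x) / d)).congr_of_eventuallyEq
        (Filter.eventuallyEq_of_mem (Metric.isOpen_ball.mem_nhds hw) e1)
      have h1 := ((hasDerivAt_id w).mul (hτ w hw)).unique h0
      simp only [id] at h1
      linear_combination h1 - e2 w hw
    have h0 := (hasDerivAt_const w₀ (-((σ' x₀ - σ' x) / d))).congr_of_eventuallyEq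
        (Filter.eventuallyEq_of_mem (Metric.ball_mem_nhds _ hr) e3)
    have h1 := (hτ w₀ hw₀).unique h0
    have h2 := e2 w₀ hw₀
    rw [h1, mul_zero] at h2
    exact hτ0 (by rw [e3 w₀ hw₀, ← h2, neg_zero])

/-- A function on a box whose derivative in the second variable vanishes depends on the first
variable only. -/
theorem eq_of_fderiv_snd_eq_zero {F : ℝ × ℝ → ℝ} {x : ℝ} {w₀ r : ℝ}
    (hF : ∀ w ∈ Metric.ball w₀ r, DifferentiableAt ℝ F (x, w))
    (h0 : ∀ w ∈ Metric.ball w₀ r, fderiv ℝ F (x, w) (0, 1) = 0)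
    {w w' : ℝ} (hw : w ∈ Metric.ball w₀ r) (hw' : w' ∈ Metric.ball w₀ r) :
    F (x, w) = F (x, w') := by
  have hd : ∀ w ∈ Metric.ball w₀ r, HasDerivAt (fun w => F (x, w)) 0 w := by
    intro w hw
    rw [← h0 w hw]
    exact (hF w hw).hasFDerivAt.comp_hasDerivAt w
      ((hasDerivAt_const w x).prodMk (hasDerivAt_id w))
  refine Metric.isOpen_ball.is_const_of_deriv_eq_zero (convex_ball w₀ r).isPreconnected
    (fun y hy => (hd y hy).differentiableAt.differentiableWithinAt) (fun y hy => (hd y hy).deriv)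
    hw hw'

theorem eq_of_fderiv_fst_eq_zero {F : ℝ × ℝ → ℝ} {w : ℝ} {x₀ r : ℝ}
    (hF : ∀ x ∈ Metric.ball x₀ r, DifferentiableAt ℝ F (x, w))
    (h0 : ∀ x ∈ Metric.ball x₀ r, fderiv ℝ F (x, w) (1, 0) = 0)
    {x x' : ℝ} (hx : x ∈ Metric.ball x₀ r) (hx' : x' ∈ Metric.ball x₀ r) :
    F (x, w) = F (x', w) := by
  have hd : ∀ x ∈ Metric.ball x₀ r, HasDerivAt (fun x => F (x, w)) 0 x := by
    intro x hx
    rw [← h0 x hx]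
    exact (hF x hx).hasFDerivAt.comp_hasDerivAt x
      ((hasDerivAt_id x).prodMk (hasDerivAt_const x w))
  refine Metric.isOpen_ball.is_const_of_deriv_eq_zero (convex_ball x₀ r).isPreconnected
    (fun y hy => (hd y hy).differentiableAt.differentiableWithinAt) (fun y hy => (hd y hy).deriv)
    hx hx'

/-- Parametrize a putative surface by (x², y²). The two equations of a transversal plane, tested on
the two coordinate tangent vectors, separate the variables and reduce to `not_separated`. -/
theorem not_transversallyGeodesic {D : Set Pt} (hne : D.Nonempty) (hsub : D ⊆ regularSet) :
    ¬ TransversallyGeodesic expWeb D := by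
  intro h
  obtain ⟨z, hz⟩ := hne
  -- Both components of ξ must be nonzero: ξ² ≠ 0 makes the surface a graph over (x², y²), and ξ¹ ≠
  -- 0 gives σ' ≠ 0 at the base point.
  obtain ⟨U, Φ, u₀, hS, hu₀, rfl, hT, hη⟩ :=
    h z hz ![1, 1] (fun h => by simpa using congrFun h 0)
  have hR : ∀ u ∈ U, Φ u ∈ regularSet := fun u hu => hsub (hS.mapsTo u hu)
  obtain ⟨g, hg0, hg⟩ := hS.exists_graph hu₀ ((dx 1).prod (dy 1)) (by
    intro v hv hv0
    have ⟨h1, h2, h3⟩ := hR _ hu₀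
    rw [hT] at hv
    simp only [ContinuousLinearMap.prod_apply, dx_apply, dy_apply, Prod.mk_eq_zero] at hv0
    simp [transversalPlane, om1_zero, om1_one, om2_zero, om2_one, hv0, h1, h2, h3] at hv
    ext i <;> fin_cases i <;> simp [hv, hv0])
  set G : ℝ × ℝ → Pt := fun x => Φ (g x)
  set x₀ := (Φ u₀).1 1
  set w₀ := (Φ u₀).2 1
  obtain ⟨r, hr, hG⟩ := Metric.eventually_nhds_iff_ball.1 hg
  change ∀ y ∈ Metric.ball (x₀, w₀) r, _ at hG
  simp only [← ball_prod_same, Set.mem_prod, Prod.forall, and_imp] at hG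
  have hx₀ := Metric.mem_ball_self (x := x₀) hr
  have hw₀ := Metric.mem_ball_self (x := w₀) hr
  have hGR : ∀ x ∈ Metric.ball x₀ r, ∀ w ∈ Metric.ball w₀ r,
      (G (x, w)).1 0 ≠ 0 ∧ (G (x, w)).2 0 ≠ 0 ∧ (G (x, w)).2 1 = w ∧ w ≠ 0 := by
    intro x hx w hw
    obtain ⟨hU, hπ, -⟩ := hG x w hx hw
    obtain ⟨h1, h2, h3⟩ := hR _ hU
    have : (G (x, w)).2 1 = w := congrArg Prod.snd hπ
    exact ⟨h1, h2, this, this ▸ h3⟩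
  have hs : ∀ x ∈ Metric.ball x₀ r, ∀ w ∈ Metric.ball w₀ r,
      HasFDerivAt (fun y => (G y).1 0) ((dx 0).comp (fderiv ℝ G (x, w))) (x, w) :=
    fun x hx w hw => (dx 0).hasFDerivAt.comp _ (hG x w hx hw).2.2.1.hasFDerivAt
  have ht : ∀ x ∈ Metric.ball x₀ r, ∀ w ∈ Metric.ball w₀ r,
      HasFDerivAt (fun y => (G y).2 0) ((dy 0).comp (fderiv ℝ G (x, w))) (x, w) :=
    fun x hx w hw => (dy 0).hasFDerivAt.comp _ (hG x w hx hw).2.2.1.hasFDerivAt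
  have key : ∀ x ∈ Metric.ball x₀ r, ∀ w ∈ Metric.ball w₀ r,
      (fderiv ℝ G (x, w) (0, 1)).1 0 = 0 ∧ (fderiv ℝ G (x, w) (1, 0)).2 0 = 0 ∧
      w * (G (x, w)).2 0 * (fderiv ℝ G (x, w) (1, 0)).1 0 =
        w * (G (x, w)).1 0 * (fderiv ℝ G (x, w) (0, 1)).2 0 + 1 := by
    intro x hx w hw
    obtain ⟨hs0, ht0, hGw, hw0⟩ := hGR x hx w hw
    obtain ⟨hU, -, -, hv⟩ := hG x w hx hw
    obtain ⟨η, hη0, hηT⟩ := hη _ hU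
    obtain ⟨a1, a2⟩ := hv 1 0
    obtain ⟨b1, b2⟩ := hv 0 1
    rw [hηT] at a1 b1
    change fderiv ℝ G (x, w) (1, 0) ∈ transversalPlane expWeb η (G (x, w)) at a1
    change fderiv ℝ G (x, w) (0, 1) ∈ transversalPlane expWeb η (G (x, w)) at b1
    simp only [ContinuousLinearMap.prod_apply, dx_apply, dy_apply, Prod.mk.injEq] at a2 b2
    simp only [transversalPlane, om1_zero, om1_one, om2_zero, om2_one, Set.mem_ofPred_eq, a2, b2,
      hGw] at a1 b1
    obtain ⟨a3, a4⟩ := a1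
    obtain ⟨b3, b4⟩ := b1
    have hE := (Real.exp_pos ((G (x, w)).1 0 * (G (x, w)).2 0)).ne'
    -- The tangent vector over (1, 0) has ω₁² = 1, so η² = 0 would force η¹ = 0 as well.
    have hη1 : η 1 ≠ 0 := by
      intro h1
      have h0 : η 0 = 0 := by simpa [h1] using a3
      exact hη0 (by ext i; fin_cases i <;> simp [h0, h1])
    refine ⟨by simpa [hη1, hE, hw0, ht0] using b3, by simpa [hη1, hE, hw0, hs0] using a4, ?_⟩
    -- The ω₁ equation on the first vector and the ω₂ equation on the second both have right side
    -- η¹; equating them eliminates it.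
    apply mul_left_cancel₀ (mul_ne_zero hη1 hE)
    linear_combination a3 - b4
  have hσ' : (fderiv ℝ G (x₀, w₀) (1, 0)).1 0 ≠ 0 := by
    intro h0
    obtain ⟨-, -, -, hv⟩ := hG x₀ w₀ hx₀ hw₀
    obtain ⟨a1, a2⟩ := hv 1 0
    have : g (x₀, w₀) = u₀ := hg0
    rw [this, hT] at a1
    simp only [ContinuousLinearMap.prod_apply, dx_apply, dy_apply, Prod.mk.injEq] at a2
    simp [transversalPlane, om1_zero, om1_one, a2] at a1
    exact absurd a1.1 (by simp [h0])
  have hsc : ∀ x ∈ Metric.ball x₀ r, ∀ w ∈ Metric.ball w₀ r, (G (x, w)).1 0 = (G (x, w₀)).1 0 :=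
    fun x hx w hw => eq_of_fderiv_snd_eq_zero (F := fun y => (G y).1 0)
      (fun w hw => (hs x hx w hw).differentiableAt)
      (fun w hw => by rw [(hs x hx w hw).fderiv]; exact (key x hx w hw).1) hw hw₀
  have htc : ∀ x ∈ Metric.ball x₀ r, ∀ w ∈ Metric.ball w₀ r, (G (x, w)).2 0 = (G (x₀, w)).2 0 :=
    fun x hx w hw => eq_of_fderiv_fst_eq_zero (F := fun y => (G y).2 0)
      (fun x hx => (ht x hx w hw).differentiableAt)
      (fun x hx => by rw [(ht x hx w hw).fderiv]; exact (key x hx w hw).2.1) hx hx₀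
  have hσd : ∀ x ∈ Metric.ball x₀ r, ∀ w ∈ Metric.ball w₀ r,
      HasDerivAt (fun x => (G (x, w₀)).1 0) ((fderiv ℝ G (x, w) (1, 0)).1 0) x := by
    intro x hx w hw
    have h1 : HasDerivAt (fun x => (G (x, w)).1 0) ((fderiv ℝ G (x, w) (1, 0)).1 0) x :=
      (hs x hx w hw).comp_hasDerivAt (f := fun x => (x, w)) x
        ((hasDerivAt_id x).prodMk (hasDerivAt_const x w))
    exact h1.congr_of_eventuallyEq (Filter.eventuallyEq_of_mem (Metric.isOpen_ball.mem_nhds hx)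
      fun y hy => (hsc y hy w hw).symm)
  have hτd : ∀ x ∈ Metric.ball x₀ r, ∀ w ∈ Metric.ball w₀ r,
      HasDerivAt (fun w => (G (x₀, w)).2 0) ((fderiv ℝ G (x, w) (0, 1)).2 0) w := by
    intro x hx w hw
    have h1 : HasDerivAt (fun w => (G (x, w)).2 0) ((fderiv ℝ G (x, w) (0, 1)).2 0) w :=
      (ht x hx w hw).comp_hasDerivAt (f := fun w => (x, w)) w
        ((hasDerivAt_const w x).prodMk (hasDerivAt_id w))
    exact h1.congr_of_eventuallyEq (Filter.eventuallyEq_of_mem (Metric.isOpen_ball.mem_nhds hw)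
      fun y hy => (htc x hx y hy).symm)
  refine not_separated (σ := fun x => (G (x, w₀)).1 0) (τ := fun w => (G (x₀, w)).2 0)
    (σ' := fun x => (fderiv ℝ G (x, w₀) (1, 0)).1 0)
    (τ' := fun w => (fderiv ℝ G (x₀, w) (0, 1)).2 0) hr (hσd x₀ hx₀ w₀ hw₀)
    (fun w hw => hτd x₀ hx₀ w hw) (hGR x₀ hx₀ w₀ hw₀).2.1 hσ' ?_
  intro x hx w hw
  have := (key x hx w hw).2.2
  rwa [hsc x hx w hw, htc x hx w hw, (hσd x hx w hw).unique (hσd x hx w₀ hw₀),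
    (hτd x hx w hw).unique (hτd x₀ hx₀ w hw)] at this

/-! ### Integral surfaces of Δ: existence, parallelism, hexagonality. -/

theorem integrable_Delta {D : Set Pt} (hD : IsOpen D) (hsub : D ⊆ regularSet) :
    Integrable D (Delta expWeb) := by
  intro z hz
  set L : ℝ × ℝ →L[ℝ] Pt :=
    (ContinuousLinearMap.pi ![ContinuousLinearMap.fst ℝ ℝ ℝ, 0]).prod
      (ContinuousLinearMap.pi ![ContinuousLinearMap.snd ℝ ℝ ℝ, 0]) with hL
  have hL' : ∀ u : ℝ × ℝ, L u = (![u.1, 0], ![u.2, 0]) := by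
    intro u
    ext i <;> fin_cases i <;> simp [hL]
  -- The leaf through z is the affine plane on which x² and y² keep their values at z.
  set Φ : ℝ × ℝ → Pt := fun u => L u + (![0, z.1 1], ![0, z.2 1]) with hΦ
  have hd : ∀ u, fderiv ℝ Φ u = L := fun u => (L.hasFDerivAt.add_const _).fderiv
  have hs : ContDiff ℝ ∞ Φ := L.contDiff.add contDiff_const
  refine ⟨Φ ⁻¹' D, Φ, (z.1 0, z.2 0), ⟨⟨hD.preimage hs.continuous, hs.contDiffOn,
    fun u hu => hu, ?_⟩, ?_⟩, ?_⟩
  · intro u _ v v' h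
    rw [hd, hL', hL'] at h
    have h1 := congrFun (congrArg Prod.fst h) 0
    have h2 := congrFun (congrArg Prod.snd h) 0
    exact Prod.ext h1 h2
  · intro u hu
    ext v
    rw [mem_Delta_iff (hsub hu), tangentPlane, hd]
    constructor
    · rintro ⟨w, rfl⟩
      simp [hL']
    · rintro ⟨h1, h2⟩
      refine ⟨(v.1 0, v.2 0), ?_⟩
      rw [hL']
      ext i <;> fin_cases i <;> simp [h1, h2]
  · have : Φ (z.1 0, z.2 0) = z := by
      ext i <;> fin_cases i <;> simp [hΦ, hL']
    exact ⟨by rwa [Set.mem_preimage, this], this⟩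

/-- Only the index-2 component matters since a₁ = 0, and there θⱼ² = 0 for all P, Q because ωⱼ² and
a²ⱼₖ vanish. What remains is the derivative of components of V that are zero on the open set D. -/
theorem geodesiclyParallel_expWeb {D : Set Pt} (hD : IsOpen D) (hsub : D ⊆ regularSet) :
    GeodesiclyParallel expWeb D := by
  intro P Q V _ hV z hz X
  have hV' : ∀ w ∈ D, (V w).1 1 = 0 ∧ (V w).2 1 = 0 := fun w hw =>
    (mem_Delta_iff (hsub hw) _).1 (hV w hw)
  have d1 : fderiv ℝ (fun w => (V w).1 1) z = 0 := by
    rw [(Filter.eventuallyEq_of_mem (hD.mem_nhds hz) fun w hw => (hV' w hw).1).fderiv_eq]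
    simp
  have d2 : fderiv ℝ (fun w => (V w).2 1) z = 0 := by
    rw [(Filter.eventuallyEq_of_mem (hD.mem_nhds hz) fun w hw => (hV' w hw).2).fderiv_eq]
    simp
  simp [Fin.sum_univ_two, cov_zero_expWeb, covDeriv1, covDeriv2, theta, conn_one, torsion_one,
    om1_one, om2_one, d1, d2]

/-- Locally (x¹, y¹) are coordinates on the surface and y² is constant, so equal values of the web
function mean equal products x¹y¹. -/
theorem hexagonalOn_expWeb {D : Set Pt} (hsub : D ⊆ regularSet) {U : Set (ℝ × ℝ)}
    {Φ : ℝ × ℝ → Pt} (h : IsIntegralSurface D (Delta expWeb) U Φ) : HexagonalOn expWeb U Φ := by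
  have hR : ∀ u ∈ U, Φ u ∈ regularSet := fun u hu => hsub (h.mapsTo u hu)
  have hT : ∀ u ∈ U, ∀ v, (fderiv ℝ Φ u v).1 1 = 0 ∧ (fderiv ℝ Φ u v).2 1 = 0 := by
    intro u hu v
    rw [← mem_Delta_iff (hR u hu), ← h.tangent u hu]
    exact ⟨v, rfl⟩
  intro u₀ hu₀
  obtain ⟨e, he⟩ := h.exists_equiv hu₀ ((dx 0).prod (dy 0)) (by
    intro v hv hv0
    rw [h.tangent _ hu₀, mem_Delta_iff (hR _ hu₀)] at hv
    simp only [ContinuousLinearMap.prod_apply, dx_apply, dy_apply, Prod.mk_eq_zero] at hv0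
    ext i <;> fin_cases i <;> simp [hv, hv0])
  have hc : ContDiffAt ℝ ∞ (fun u => (dx 0).prod (dy 0) (Φ u)) u₀ :=
    ((dx 0).prod (dy 0)).contDiff.contDiffAt.comp u₀ (h.contDiffAt hu₀)
  have hs := hc.hasStrictFDerivAt' he (by simp)
  have hN : U ∩ (hs.toOpenPartialHomeomorph _).source ∈ 𝓝 u₀ :=
    Filter.inter_mem (h.isOpen.mem_nhds hu₀)
      ((hs.toOpenPartialHomeomorph _).open_source.mem_nhds hs.mem_toOpenPartialHomeomorph_source)
  obtain ⟨r, hr, hB⟩ := Metric.mem_nhds_iff.1 hN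
  have hinj : ∀ A ∈ Metric.ball u₀ r, ∀ B ∈ Metric.ball u₀ r,
      (Φ A).1 0 = (Φ B).1 0 → (Φ A).2 0 = (Φ B).2 0 → A = B := fun A hA B hB' h1 h2 =>
    (hs.toOpenPartialHomeomorph _).injOn (hB hA).2 (hB hB').2 (Prod.ext h1 h2)
  have hdx : ∀ u ∈ Metric.ball u₀ r, HasFDerivAt (fun u => (Φ u).1 1) (0 : ℝ × ℝ →L[ℝ] ℝ) u := by
    intro u hu
    rw [show (0 : ℝ × ℝ →L[ℝ] ℝ) = (dx 1).comp (fderiv ℝ Φ u) from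
      ContinuousLinearMap.ext fun v => (hT u (hB hu).1 v).1.symm]
    exact (dx 1).hasFDerivAt.comp u
      ((h.contDiffAt (hB hu).1).differentiableAt (by simp)).hasFDerivAt
  have hdy : ∀ u ∈ Metric.ball u₀ r, HasFDerivAt (fun u => (Φ u).2 1) (0 : ℝ × ℝ →L[ℝ] ℝ) u := by
    intro u hu
    rw [show (0 : ℝ × ℝ →L[ℝ] ℝ) = (dy 1).comp (fderiv ℝ Φ u) from
      ContinuousLinearMap.ext fun v => (hT u (hB hu).1 v).2.symm]
    exact (dy 1).hasFDerivAt.comp u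
      ((h.contDiffAt (hB hu).1).differentiableAt (by simp)).hasFDerivAt
  have hy : ∀ A ∈ Metric.ball u₀ r, (Φ A).2 1 = (Φ u₀).2 1 := fun A hA =>
    Metric.isOpen_ball.is_const_of_fderiv_eq_zero (𝕜 := ℝ) (convex_ball u₀ r).isPreconnected
      (fun u hu => (hdy u hu).differentiableAt.differentiableWithinAt)
      (fun u hu => (hdy u hu).fderiv) hA (Metric.mem_ball_self hr)
  have hf : ∀ A ∈ Metric.ball u₀ r, ∀ B ∈ Metric.ball u₀ r,
      expWeb (Φ A) = expWeb (Φ B) → (Φ A).1 0 * (Φ A).2 0 = (Φ B).1 0 * (Φ B).2 0 := by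
    intro A hA B hB' hAB
    have h0 := congrFun hAB 0
    simp only [expWeb, Matrix.cons_val_zero, hy A hA, hy B hB'] at h0
    exact Real.exp_injective (mul_left_cancel₀ (hR u₀ hu₀).2.2 h0)
  refine ⟨Metric.ball u₀ r, Metric.ball_mem_nhds _ hr, fun u hu => (hB hu).1, ?_⟩
  intro O hO A₁ h₁ A₂ h₂ A₃ h₃ A₄ h₄ A₅ h₅ A₆ h₆ A₇ h₇ e₁ f₂ e₂ e₃ f₃ e₄ e₄' f₅ e₅ e₆ f₆ e₇ e₇'
  apply hinj _ h₇ _ h₁ (by rw [e₇', e₁])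
  have k₂ := hf _ h₂ _ h₁ f₂
  have k₃ := hf _ h₃ _ hO f₃
  have k₅ := hf _ h₅ _ h₄ f₅
  have k₆ := hf _ h₆ _ hO f₆
  rw [e₁, e₂] at k₂
  rw [e₃, ← e₄] at k₃
  rw [e₄', e₅] at k₅
  rw [e₆, ← e₇] at k₆
  obtain ⟨s0, t0, -⟩ := hR _ (hB hO).1
  obtain ⟨-, t1, -⟩ := hR _ (hB h₁).1
  obtain ⟨s2, -, -⟩ := hR _ (hB h₂).1
  obtain ⟨s5, -, -⟩ := hR _ (hB h₅).1
  -- With s = x¹ and t = y¹, the four product relations are s₂t₀ = s₀t₁, s₂t₄ = s₀t₀, s₅t₀ = s₀t₄,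
  -- s₅t₇ = s₀t₀. The middle two give s₅s₂ = s₀², and the outer two then give t₇ = t₁.
  apply mul_left_cancel₀ (mul_ne_zero s5 s2)
  have : (Φ A₅).1 0 * (Φ A₂).1 0 = (Φ O).1 0 * (Φ O).1 0 := by
    apply mul_left_cancel₀ t0
    linear_combination (Φ A₂).1 0 * k₅ + (Φ O).1 0 * k₃
  linear_combination (Φ A₂).1 0 * k₆ + (Φ O).1 0 * k₂ - (Φ A₁).2 0 * this

/-! ### Collecting the class conditions. -/

theorem classA3_expWeb {D : Set Pt} (hD : IsOpen D) (hsub : D ⊆ regularSet) :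
    ClassA3 expWeb D where
  isWeb := isWeb_expWeb hD hsub
  cov_ne_zero z hz := ⟨1, cov_one_ne_zero (hsub hz)⟩
  nonIsoclinic z hz := by
    have := pS_ne_zero (hsub hz)
    positivity
  delta_eq z hz := by
    ext v
    rw [mem_Delta_iff (hsub hz), Set.mem_ofPred_eq, om1_one, om2_one]
  integrable := integrable_Delta hD hsub
  cov_zero z _ := cov_zero_expWeb z
  pi_zero z _ v _ := conn_one 0 z v
  pT_zero z _ := pT_zero_expWeb 0 z
  qT_zero z _ := qT_zero_expWeb 0 z

end Web322

theorem mainTheorem8 (D : Set Web322.Pt) (hD : IsOpen D) (hne : D.Nonempty)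
    (hsub : ∀ z ∈ D, z.1 0 ≠ 0 ∧ z.2 0 ≠ 0 ∧ z.2 1 ≠ 0) :
    Web322.IsWeb Web322.expWeb D ∧
    Web322.NonIsoclinicGeodesic Web322.expWeb D ∧
    Web322.NonIsoclinic Web322.expWeb D ∧
    Web322.ClassA31 Web322.expWeb D ∧
    Web322.ClassA32 Web322.expWeb D ∧
    Web322.ClassE321 Web322.expWeb D ∧
    Web322.ClassG3 Web322.expWeb D ∧
    (∀ z ∈ D, ∀ j k l, Web322.curv Web322.expWeb 1 j k l z = 0) ∧
    ¬ Web322.CurvatureVanishes Web322.expWeb D ∧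
    Web322.ClassC Web322.expWeb D := by
  have hA := Web322.classA3_expWeb hD hsub
  refine ⟨hA.isWeb, hA.cov_ne_zero, hA.nonIsoclinic,
    ⟨hA, Web322.geodesiclyParallel_expWeb hD hsub, fun z _ i => Web322.pT_zero_expWeb i z,
      fun z _ i => Web322.qT_zero_expWeb i z⟩,
    ⟨hA, fun U Φ h => Web322.hexagonalOn_expWeb hsub h, fun z hz i => ?_⟩,
    ⟨fun z _ i => Web322.pT_zero_expWeb i z, fun z _ i => Web322.qT_zero_expWeb i z,
      fun z hz => ?_, fun z hz => Web322.pT_one_one (hsub z hz)⟩,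
    fun z hz => ⟨Web322.pS_eq_qS (hsub z hz), Web322.pS_ne_zero (hsub z hz)⟩,
    fun z _ j k l => Web322.curv_one j k l z, fun h => ?_,
    ⟨Web322.not_transversallyGeodesic hne hsub, Web322.not_curvatureTransversal hne hsub⟩⟩
  · fin_cases i
    · exact Web322.curv_zero_zero 0 0 (hsub z hz)
    · exact Web322.curv_one 0 0 0 z
  · rw [Web322.pT_one_zero (hsub z hz), Web322.qT_one_zero (hsub z hz)]
  · obtain ⟨z, hz⟩ := hne
    exact Web322.curv_zero_one_zero_zero_ne_zero (hsub z hz) (h z hz 0 1 0 0)
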